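/- For a Boolean algebra $B$ and a subalgebra $A\le B$ write $A\leq_{sep}B$ if for every $b\in B$ and every uncountable $T\subseteq A\restriction b=\{a\in A: a\le b\}$ there is $a\in A\restriction b$ such that $\{c\in T: c\le a\}$ is uncountable. For a cardinal $\chi$ let $\mathcal H_\chi$ be the set of all sets whose transitive closure has cardinality less than $\chi$, and let $\mathcal M_\chi$ be the set of elementary submodels $M$ of $(\mathcal H_\chi,\in)$ such that $|M|=\aleph_1$ and $[M]^{\aleph_0}\cap M$ is cofinal in $([M]^{\aleph_0},\subseteq)$. Let $\mathrm{SEP}(\mathcal P(\omega))$ be the statement: for all sufficiently large regular cardinals $\chi$ there are cofinally many $M\in\mathcal M_\chi$ such that $\mathcal P(\omega)\cap M\leq_{sep}\mathcal P(\omega)$ (that is, every subset of $\mathcal H_\chi$ of size at most $\aleph_1$ is included in such an $M$). Call a subset of $[\omega]^{\aleph_0}$ (the set of infinite subsets of $\omega$) groupwise dense if it is closed under taking almost subsets (if $x$ belongs to it and $y\in[\omega]^{\aleph_0}$ has $y\setminus x$ finite, then $y$ belongs to it) and it is non-meager in the topology that $[\omega]^{\aleph_0}$ inherits from $2^\omega$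 via characteristic functions. **Theorem.** Assume $\mathrm{SEP}(\mathcal P(\omega))$. Then 1. $\mathrm{non}(\mathcal M)=\aleph_1$, where $\mathrm{non}(\mathcal M)$ is the smallest size of a non-meager subset of $\mathbb R$; 2. $\mathfrak g=\aleph_1$, where $\mathfrak g$ is the smallest size of a family of groupwise dense subsets of $[\omega]^{\aleph_0}$ with empty intersection. Moreover, if the Continuum Hypothesis $2^{\aleph_0}=\aleph_1$ fails, then $\mathrm{cov}(\mathcal M)\ge\aleph_2$, where $\mathrm{cov}(\mathcal M)$ is the smallest size of a family of meager subsets of $\mathbb R$ covering $\mathbb R$. -/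

import Mathlib

open scoped Cardinal

/-! ### Separable embeddings of Boolean algebras -/

/-- `A ≤_sep B`: for every `b : B` and every uncountable `T ⊆ A ↾ b = {a ∈ A | a ≤ b}` there is
`a ∈ A ↾ b` such that uncountably many elements of `T` lie below `a`. -/
def IsSepSubalgebra {B : Type*} [BooleanAlgebra B] (A : BooleanSubalgebra B) : Prop :=
  ∀ b : B, ∀ T : Set B, T ⊆ {a | a ∈ A ∧ a ≤ b} → ¬ T.Countable →
    ∃ a ∈ A, a ≤ b ∧ ¬ {c | c ∈ T ∧ c ≤ a}.Countable

/-! ### The structures `(H_χ, ∈)` and their elementary submodels -/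

/-- `H_χ`: the class of all sets whose transitive closure has fewer than `χ` elements. -/
def hereditary (χ : Cardinal.{0}) : Set ZFSet.{0} :=
  {x | #{y : ZFSet.{0} | Relation.TransGen (· ∈ ·) y x} < Cardinal.lift.{1, 0} χ}

/-- The only relation symbol of the language of set theory is the binary symbol for membership. -/
inductive SetTheoryRel : ℕ → Type
  | mem : SetTheoryRel 2

/-- The first-order language of set theory. -/
def setTheoryLanguage : FirstOrder.Language.{0, 0} where
  Functions := fun _ => Empty
  Relations := SetTheoryRel

/-- A class of sets is a structure for the language of set theory, with the true membership
relation. -/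
instance setTheoryStructure (H : Set ZFSet.{0}) : setTheoryLanguage.Structure H where
  funMap := fun f _ => f.elim
  RelMap := fun r v =>
    match r, v with
    | SetTheoryRel.mem, v => (v 0 : ZFSet.{0}) ∈ (v 1 : ZFSet.{0})

/-- The underlying class of sets of an elementary submodel `M` of `H_χ`. -/
def submodelCarrier {χ : Cardinal.{0}}
    (M : setTheoryLanguage.ElementarySubstructure (hereditary χ)) : Set ZFSet.{0} :=
  Subtype.val '' (M : Set (hereditary χ))

/-- `M ∈ 𝓜_χ`: the elementary submodel `M` of `H_χ` has cardinality `ℵ₁`, and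
`[M]^ℵ₀ ∩ M` is cofinal in `[M]^ℵ₀`. -/
def IsGoodSubmodel {χ : Cardinal.{0}}
    (M : setTheoryLanguage.ElementarySubstructure (hereditary χ)) : Prop :=
  #(submodelCarrier M) = ℵ₁ ∧
    ∀ x : Set ZFSet.{0}, x ⊆ submodelCarrier M → #x = ℵ₀ →
      ∃ y ∈ submodelCarrier M, (y : Set ZFSet.{0}) ⊆ submodelCarrier M ∧
        #(y : Set ZFSet.{0}) = ℵ₀ ∧ x ⊆ (y : Set ZFSet.{0})

/-- `SEP(A)`, for a set `A` carrying a Boolean algebra structure: for all sufficiently large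
regular `χ` there are cofinally many `M ∈ 𝓜_χ` (that is, every subset of `H_χ` of size at most
`ℵ₁` is included in such an `M`) for which `A ∩ M` is a subalgebra of `A` with
`A ∩ M ≤_sep A`. -/
def SEP (A : ZFSet.{0}) [BooleanAlgebra A] : Prop :=
  ∃ χ₀ : Cardinal.{0}, ∀ χ : Cardinal.{0}, χ₀ ≤ χ → χ.IsRegular →
    ∀ X : Set ZFSet.{0}, X ⊆ hereditary χ → #X ≤ ℵ₁ →
      ∃ M : setTheoryLanguage.ElementarySubstructure (hereditary χ),
        IsGoodSubmodel M ∧ X ⊆ submodelCarrier M ∧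
        ∃ S : BooleanSubalgebra A,
          (S : Set A) = {a : A | (a : ZFSet.{0}) ∈ submodelCarrier M} ∧ IsSepSubalgebra S

/-- The power set of a set `a`, as a Boolean algebra ordered by inclusion, with the operations
`x ∪ y`, `x ∩ y` and `a \ x`. -/
instance powersetBooleanAlgebra (a : ZFSet.{0}) : BooleanAlgebra (ZFSet.powerset a) :=
  { (inferInstance : PartialOrder (ZFSet.powerset a)) with
    sup := fun x y => ⟨x.1 ∪ y.1, ZFSet.mem_powerset.2 fun z hz =>
      (ZFSet.mem_union.1 hz).elim (fun h => ZFSet.mem_powerset.1 x.2 h)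
        (fun h => ZFSet.mem_powerset.1 y.2 h)⟩
    inf := fun x y => ⟨x.1 ∩ y.1, ZFSet.mem_powerset.2 fun _ hz =>
      ZFSet.mem_powerset.1 x.2 (ZFSet.mem_inter.1 hz).1⟩
    compl := fun x => ⟨a \ x.1, ZFSet.mem_powerset.2 fun _ hz => (ZFSet.mem_sdiff.1 hz).1⟩
    top := ⟨a, ZFSet.mem_powerset.2 fun _ h => h⟩
    bot := ⟨∅, ZFSet.mem_powerset.2 fun z h => absurd h (ZFSet.notMem_empty z)⟩
    le_sup_left := fun _ _ _ h => ZFSet.mem_union.2 (Or.inl h)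
    le_sup_right := fun _ _ _ h => ZFSet.mem_union.2 (Or.inr h)
    sup_le := fun _ _ _ h₁ h₂ _ h => (ZFSet.mem_union.1 h).elim (fun h => h₁ h) (fun h => h₂ h)
    inf_le_left := fun _ _ _ h => (ZFSet.mem_inter.1 h).1
    inf_le_right := fun _ _ _ h => (ZFSet.mem_inter.1 h).2
    le_inf := fun _ _ _ h₁ h₂ _ h => ZFSet.mem_inter.2 ⟨h₁ h, h₂ h⟩
    le_sup_inf := fun x y z w h => by
      have h' : w ∈ (x.1 ∪ y.1) ∩ (x.1 ∪ z.1) := h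
      show w ∈ x.1 ∪ (y.1 ∩ z.1)
      simp only [ZFSet.mem_inter, ZFSet.mem_union] at h' ⊢
      tauto
    inf_compl_le_bot := fun x w h => by
      have h' : w ∈ x.1 ∩ (a \ x.1) := h
      simp only [ZFSet.mem_inter, ZFSet.mem_sdiff] at h'
      exact absurd h'.1 h'.2.2
    top_le_sup_compl := fun x w h => by
      have h' : w ∈ a := h
      show w ∈ x.1 ∪ (a \ x.1)
      simp only [ZFSet.mem_union, ZFSet.mem_sdiff]
      tauto
    le_top := fun x _ h => ZFSet.mem_powerset.1 x.2 h
    bot_le := fun _ w h => absurd h (ZFSet.notMem_empty w) }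

/-! ### Cardinal invariants of the continuum -/

/-- `non(𝓜)`: the smallest size of a non-meager subset of `ℝ`. -/
noncomputable def nonMeager : Cardinal.{0} :=
  sInf {κ | ∃ X : Set ℝ, ¬ IsMeagre X ∧ #X = κ}

/-- `cov(𝓜)`: the smallest size of a family of meager subsets of `ℝ` covering `ℝ`. -/
noncomputable def covMeager : Cardinal.{0} :=
  sInf {κ | ∃ F : Set (Set ℝ), (∀ X ∈ F, IsMeagre X) ∧ ⋃₀ F = Set.univ ∧ #F = κ}

/-- `[ω]^ℵ₀`: the infinite subsets of `ω`. -/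
def InfiniteSubset : Type := {x : Set ℕ // x.Infinite}

open Classical in
/-- The characteristic function, as a point of the Cantor space `2^ω`. -/
noncomputable def InfiniteSubset.char (x : InfiniteSubset) : ℕ → Bool :=
  fun n => decide (n ∈ x.1)

/-- The topology that `[ω]^ℵ₀` inherits from the Cantor space. -/
noncomputable instance infiniteSubsetTopology : TopologicalSpace InfiniteSubset :=
  TopologicalSpace.induced InfiniteSubset.char inferInstance

/-- A groupwise dense subset of `[ω]^ℵ₀` is one that is closed under taking almost subsets and
non-meager. -/
def IsGroupwiseDense (G : Set InfiniteSubset) : Prop :=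
  (∀ x ∈ G, ∀ y : InfiniteSubset, (y.1 \ x.1).Finite → y ∈ G) ∧ ¬ IsMeagre G

/-- The groupwise density number `𝔤`: the smallest size of a family of groupwise dense subsets
of `[ω]^ℵ₀` with empty intersection. -/
noncomputable def groupwiseDensityNumber : Cardinal.{0} :=
  sInf {κ | ∃ F : Set (Set InfiniteSubset), (∀ G ∈ F, IsGroupwiseDense G) ∧ ⋂₀ F = ∅ ∧ #F = κ}

/-! Elementary submodels matter only in `SEP.exists_family`, which extracts a family `A` of at most
`ℵ₁` subsets of `ω` with the separability condition and closure under a prescribed operation `Φ` on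
sequences. Listing `A` along `ω₁`, `SEP.exists_filtration` produces sequences `s α` such that, for
each `b ⊆ ω`, all but countably many `s α` interpolate: whenever `a ∈ A` and `a ⊆ b`, some `i` has
`a ⊆ s α i ⊆ b`. Everything else uses this interpolation.

For `non(𝓜)` and `𝔤`, let `x α` avoid all meagre sets coded by `s α`. If a meagre set contained
uncountably many `x α`, an interpolant between a code of one such `x α` and a code of the meagre set
would itself code a meagre set containing `x α`. So `x` is a Luzin sequence (`SEP.exists_luzin`).
Its range in `ℝ` is non-meagre, and the almost subsets of its tails in `[ω]^ℵ₀` witness `𝔤 ≤ ℵ₁`.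

For `cov(𝓜)`, failure of CH gives `x ∈ 2^ω` with code outside `A`. A coded closed set containing `x`
is then infinite, since the members of finite ones are put into `A`. On every infinite coded set the
functions of `exists_locallyConstant_dense` realize a dense set of Cohen conditions; evaluated at
`x`, they give a nested sequence of intervals whose common point lies in all of `ℵ₁` prescribed
dense open sets. -/

open FirstOrder FirstOrder.Language

/-! ### Two formulas and their elementarity -/

/-- The membership symbol. -/
def memSymbol : setTheoryLanguage.Relations 2 := SetTheoryRel.mem

/-- The atomic formula `t₁ ∈ t₂` of the language of set theory. -/
def memFormula {α : Type} {n : ℕ} (t₁ t₂ : setTheoryLanguage.Term (α ⊕ Fin n)) :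
    setTheoryLanguage.BoundedFormula α n :=
  memSymbol.boundedFormula₂ t₁ t₂

theorem realize_memFormula {H : Set ZFSet.{0}} {α : Type} {n : ℕ}
    (t₁ t₂ : setTheoryLanguage.Term (α ⊕ Fin n)) (v : α → H) (xs : Fin n → H) :
    (memFormula t₁ t₂).Realize v xs ↔
      ((t₁.realize (Sum.elim v xs) : H) : ZFSet) ∈ ((t₂.realize (Sum.elim v xs) : H) : ZFSet) := by
  rw [memFormula, BoundedFormula.realize_rel₂]
  exact Iff.rfl

theorem realize_memFormula_substructure {H : Set ZFSet.{0}}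
    (M : setTheoryLanguage.ElementarySubstructure H) {α : Type} {n : ℕ}
    (t₁ t₂ : setTheoryLanguage.Term (α ⊕ Fin n)) (v : α → M) (xs : Fin n → M) :
    (memFormula t₁ t₂).Realize v xs ↔
      ((t₁.realize (Sum.elim v xs) : M) : ZFSet) ∈ ((t₂.realize (Sum.elim v xs) : M) : ZFSet) := by
  rw [memFormula, BoundedFormula.realize_rel₂]
  exact Iff.rfl

/-- Some member of the parameter `2` includes the intersection of the parameters `0` and `1`. -/
def coverFormula : setTheoryLanguage.Formula (Fin 3) :=
  BoundedFormula.ex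
    (memFormula (&0) (Term.var (Sum.inl 2)) ⊓
      BoundedFormula.all
        ((memFormula (&1) (Term.var (Sum.inl 0)) ⊓ memFormula (&1) (Term.var (Sum.inl 1))).imp
          (memFormula (&1) (&0))))

/-- For some member `v` of the parameter `1`, the parameter `2` has a member that contains the
parameter `0` and a set containing `v` and the parameter `1`. -/
def valueFormula : setTheoryLanguage.Formula (Fin 3) :=
  BoundedFormula.ex (BoundedFormula.ex (BoundedFormula.ex
    (memFormula (&0) (Term.var (Sum.inl 1)) ⊓
      (memFormula (&1) (Term.var (Sum.inl 2)) ⊓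
        (memFormula (Term.var (Sum.inl 0)) (&1) ⊓
          (memFormula (&2) (&1) ⊓
            (memFormula (Term.var (Sum.inl 1)) (&2) ⊓ memFormula (&0) (&2))))))))

section Submodel

variable {H : Set ZFSet.{0}} (M : setTheoryLanguage.ElementarySubstructure H)

/-- Elementarity for `coverFormula`. The inclusion obtained speaks only of members of `M`, which is
enough to cover a subset of `M`. -/
theorem ElementarySubstructure.exists_cover (a b c : M)
    (h : ∃ q : H, (q : ZFSet) ∈ (c : ZFSet) ∧
      ∀ w : H, (w : ZFSet) ∈ (a : ZFSet) ∧ (w : ZFSet) ∈ (b : ZFSet) → (w : ZFSet) ∈ (q : ZFSet)) :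
    ∃ q : M, (q : ZFSet) ∈ (c : ZFSet) ∧
      ∀ w : M, (w : ZFSet) ∈ (a : ZFSet) ∧ (w : ZFSet) ∈ (b : ZFSet) →
        (w : ZFSet) ∈ (q : ZFSet) := by
  have key := M.subtype.map_formula coverFormula ![a, b, c]
  simp only [coverFormula, Formula.Realize, BoundedFormula.realize_ex, BoundedFormula.realize_all,
    BoundedFormula.realize_inf, BoundedFormula.realize_imp, realize_memFormula,
    realize_memFormula_substructure] at key
  exact key.1 h

/-- With `b = 𝒫(ω)` and `c` a coded graph, this keeps the value at an argument in `M` inside `M`. -/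
theorem ElementarySubstructure.exists_value (a b c : M)
    (h : ∃ v r e : H, (v : ZFSet) ∈ (b : ZFSet) ∧ (r : ZFSet) ∈ (c : ZFSet) ∧
      (a : ZFSet) ∈ (r : ZFSet) ∧ (e : ZFSet) ∈ (r : ZFSet) ∧ (b : ZFSet) ∈ (e : ZFSet) ∧
      (v : ZFSet) ∈ (e : ZFSet)) :
    ∃ v r e : M, (v : ZFSet) ∈ (b : ZFSet) ∧ (r : ZFSet) ∈ (c : ZFSet) ∧
      (a : ZFSet) ∈ (r : ZFSet) ∧ (e : ZFSet) ∈ (r : ZFSet) ∧ (b : ZFSet) ∈ (e : ZFSet) ∧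
      (v : ZFSet) ∈ (e : ZFSet) := by
  have key := M.subtype.map_formula valueFormula ![a, b, c]
  simp only [valueFormula, Formula.Realize, BoundedFormula.realize_ex,
    BoundedFormula.realize_inf, realize_memFormula,
    realize_memFormula_substructure] at key
  exact key.1 h

end Submodel

/-! ### Hereditary sets and the coding of subsets of `ω` -/

theorem mem_hereditary_of_mem {χ : Cardinal.{0}} {x y : ZFSet.{0}} (hx : x ∈ hereditary χ)
    (h : y ∈ x) : y ∈ hereditary χ := by
  refine lt_of_le_of_lt (Cardinal.mk_le_mk_of_subset ?_) hx
  intro z (hz : Relation.TransGen _ _ _)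
  exact hz.tail h

/-- The transitive closure of `x` consists of sets of smaller rank, so it is contained in a set; a
large enough successor cardinal works. -/
theorem exists_isRegular_mem_hereditary (χ₀ : Cardinal.{0}) (x : ZFSet.{0}) :
    ∃ χ, χ₀ ≤ χ ∧ χ.IsRegular ∧ x ∈ hereditary χ := by
  have hsub : {y : ZFSet.{0} | Relation.TransGen (· ∈ ·) y x} ⊆ (ZFSet.vonNeumann x.rank : Set ZFSet) := by
    intro y hy
    have : y.rank < x.rank := by
      induction hy with
      | single h => exact ZFSet.rank_lt_of_mem h
      | tail _ h ih => exact ih.trans (ZFSet.rank_lt_of_mem h)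
    exact ZFSet.mem_vonNeumann.2 this
  have : Small.{0} {y : ZFSet.{0} | Relation.TransGen (· ∈ ·) y x} := by
    have : Small.{0} ((ZFSet.vonNeumann x.rank : ZFSet) : Set ZFSet) := ZFSet.small_coe _
    exact small_subset hsub
  set κ := #(Shrink.{0} {y : ZFSet.{0} | Relation.TransGen (· ∈ ·) y x}) with hκ
  refine ⟨Order.succ (max (max χ₀ κ) ℵ₀), ?_, ?_, ?_⟩
  · exact ((le_max_left _ _).trans (le_max_left _ _)).trans (Order.le_succ _)
  · exact Cardinal.isRegular_succ (le_max_right _ _)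
  · have h1 : #{y : ZFSet.{0} | Relation.TransGen (· ∈ ·) y x} = Cardinal.lift.{1} κ := by
      rw [hκ]
      have := Cardinal.mk_congr_lift.{1, 0} (equivShrink {y : ZFSet.{0} | Relation.TransGen (· ∈ ·) y x})
      simpa only [Cardinal.lift_id', Cardinal.lift_uzero, Cardinal.lift_id] using this
    rw [hereditary, Set.mem_ofPred_eq]
    rw [h1, Cardinal.lift_lt]
    exact lt_of_le_of_lt ((le_max_right _ _).trans (le_max_left _ _)) (Order.lt_succ _)

/-- The natural number `n` as a von Neumann ordinal. -/
def natSet (n : ℕ) : ZFSet.{0} := ZFSet.mk (PSet.ofNat n)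

theorem natSet_succ (n : ℕ) : natSet (n + 1) = insert (natSet n) (natSet n) := rfl

theorem natSet_mem_natSet {m n : ℕ} (h : m < n) : natSet m ∈ natSet n := by
  induction n with
  | zero => omega
  | succ n ih =>
    rw [natSet_succ, ZFSet.mem_insert_iff]
    rcases Nat.lt_succ_iff_lt_or_eq.1 h with h | rfl
    · exact Or.inr (ih h)
    · exact Or.inl rfl

theorem natSet_injective : Function.Injective natSet := by
  intro m n h
  rcases lt_trichotomy m n with h' | h' | h'
  · exact absurd (h ▸ natSet_mem_natSet h') (ZFSet.mem_irrefl _)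
  · exact h'
  · exact absurd (h ▸ natSet_mem_natSet h') (ZFSet.mem_irrefl _)

theorem mem_omega_iff_exists_natSet {x : ZFSet.{0}} : x ∈ ZFSet.omega ↔ ∃ n, natSet n = x := by
  induction x using Quotient.inductionOn with
  | h x =>
    constructor
    · rintro ⟨⟨n⟩, h⟩
      exact ⟨n, (ZFSet.sound h).symm⟩
    · rintro ⟨n, h⟩
      exact ⟨⟨n⟩, (ZFSet.exact h).symm⟩

/-- The subset of `ω` corresponding to a set of natural numbers. -/
noncomputable def subsetCode (c : Set ℕ) : ZFSet.{0} := ZFSet.range fun n : c => natSet n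

theorem natSet_mem_subsetCode {c : Set ℕ} {n : ℕ} : natSet n ∈ subsetCode c ↔ n ∈ c := by
  simp [subsetCode, natSet_injective.eq_iff]

theorem subsetCode_subset_iff {c d : Set ℕ} : subsetCode c ⊆ subsetCode d ↔ c ⊆ d := by
  refine ⟨fun h n hn => natSet_mem_subsetCode.1 (h (natSet_mem_subsetCode.2 hn)), fun h x hx => ?_⟩
  simp only [subsetCode, ZFSet.mem_range] at hx ⊢
  obtain ⟨n, rfl⟩ := hx
  exact ⟨⟨n, h n.2⟩, rfl⟩

theorem subsetCode_injective : Function.Injective subsetCode := fun _ _ h =>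
  (subsetCode_subset_iff.1 h.subset).antisymm (subsetCode_subset_iff.1 h.symm.subset)

theorem subsetCode_mem_powerset (c : Set ℕ) : subsetCode c ∈ ZFSet.powerset ZFSet.omega := by
  rw [ZFSet.mem_powerset]
  intro x hx
  simp only [subsetCode, ZFSet.mem_range] at hx
  obtain ⟨n, rfl⟩ := hx
  exact mem_omega_iff_exists_natSet.2 ⟨n, rfl⟩

theorem exists_subsetCode_eq {x : ZFSet.{0}} (hx : x ∈ ZFSet.powerset ZFSet.omega) :
    ∃ c, subsetCode c = x := by
  refine ⟨{n | natSet n ∈ x}, ?_⟩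
  ext y
  simp only [subsetCode, ZFSet.mem_range]
  constructor
  · rintro ⟨⟨n, hn⟩, rfl⟩
    exact hn
  · intro hy
    obtain ⟨n, rfl⟩ := mem_omega_iff_exists_natSet.1 (ZFSet.mem_powerset.1 hx hy)
    exact ⟨⟨n, hy⟩, rfl⟩

/-- The set of countable sets of subsets of `ω`. -/
noncomputable def countableSubsets : ZFSet.{0} :=
  ZFSet.sep (fun u => (u : Set ZFSet.{0}).Countable)
    (ZFSet.powerset (ZFSet.powerset ZFSet.omega))

theorem exists_enumeration (u : ZFSet.{0}) :
    ∃ s : ℕ → Set ℕ, u ∈ countableSubsets → ∀ c, subsetCode c ∈ u → c ∈ Set.range s := by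
  by_cases hu : u ∈ countableSubsets
  · have hc : {c | subsetCode c ∈ u}.Countable :=
      (ZFSet.mem_sep.1 hu).2.preimage subsetCode_injective
    -- Adding `∅` guarantees a nonempty set to enumerate; the range only has to cover `u`.
    obtain ⟨s, hs⟩ := (hc.insert ∅).exists_eq_range (Set.insert_nonempty _ _)
    exact ⟨s, fun _ c h => hs ▸ Set.mem_insert_of_mem _ h⟩
  · exact ⟨fun _ => ∅, fun h => absurd h hu⟩

/-- An enumeration including the codes of a countable set of subsets of `ω`. -/
noncomputable def enumeration (u : ZFSet.{0}) : ℕ → Set ℕ := (exists_enumeration u).choose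

theorem mem_range_enumeration {u : ZFSet.{0}} (hu : u ∈ countableSubsets) {c : Set ℕ}
    (hc : subsetCode c ∈ u) : c ∈ Set.range (enumeration u) :=
  (exists_enumeration u).choose_spec hu c hc

/-- The function `f` from `countableSubsets` to the power set of `ω`, coded as a set. -/
noncomputable def graphCode (f : ZFSet.{0} → Set ℕ) : ZFSet.{0} :=
  ZFSet.range fun u : countableSubsets =>
    ({u.1, {ZFSet.powerset ZFSet.omega, subsetCode (f u)}} : ZFSet.{0})

/-- The member `𝒫(ω)` tags the value side of `{u, {𝒫(ω), v}}`: by foundation it belongs to no `u ⊆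
𝒫(ω)`, so argument and value cannot be confused. -/
theorem eq_of_mem_graphCode {f : ZFSet.{0} → Set ℕ} {q v r e : ZFSet.{0}}
    (hq : q ∈ countableSubsets) (hv : v ∈ ZFSet.powerset ZFSet.omega) (hr : r ∈ graphCode f)
    (hqr : q ∈ r) (her : e ∈ r) (hpe : ZFSet.powerset ZFSet.omega ∈ e) (hve : v ∈ e) :
    v = subsetCode (f q) := by
  have hp : ∀ u ∈ countableSubsets, ZFSet.powerset ZFSet.omega ∉ u := fun u hu h =>
    ZFSet.mem_irrefl _ (ZFSet.mem_powerset.1 (ZFSet.mem_sep.1 hu).1 h)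
  simp only [graphCode, ZFSet.mem_range] at hr
  obtain ⟨⟨u, hu⟩, rfl⟩ := hr
  simp only [ZFSet.mem_pair] at hqr her
  rcases her with rfl | rfl
  · exact absurd hpe (hp _ hu)
  rcases hqr with rfl | rfl
  · rcases ZFSet.mem_pair.1 hve with rfl | rfl
    · exact absurd hv (ZFSet.mem_irrefl _)
    · rfl
  · exact absurd hpe (hp _ hq)

/-! ### From submodels to families of subsets of `ω` -/

/-- From `SEP(𝒫(ω))`, a family of at most `ℵ₁` sets of natural numbers that is closed under a given
operation on sequences covering its countable subfamilies, and to which the separability condition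
applies. -/
theorem SEP.exists_family (h : SEP (ZFSet.powerset ZFSet.omega))
    (Φ : (ℕ → Set ℕ) → ℕ → Set ℕ) (X : Set (Set ℕ)) (hX : #X ≤ ℵ₁) :
    ∃ A : Set (Set ℕ), X ⊆ A ∧ #A ≤ ℵ₁ ∧
      (∀ C ⊆ A, C.Countable → ∃ s, C ⊆ Set.range s ∧ ∀ n, Φ s n ∈ A) ∧
      ∀ b, ∀ T ⊆ A, (∀ t ∈ T, t ⊆ b) → ¬ T.Countable →
        ∃ a ∈ A, a ⊆ b ∧ ¬ {c | c ∈ T ∧ c ⊆ a}.Countable := by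
  obtain ⟨χ₀, h⟩ := h
  let p : ZFSet.{0} := ZFSet.powerset ZFSet.omega
  let W : ℕ → ZFSet.{0} := fun n => graphCode fun u => Φ (enumeration u) n
  -- One set holding all parameters, so that a single `χ` serves them all.
  let Z : ZFSet.{0} := insert p (insert countableSubsets (ZFSet.range W))
  obtain ⟨χ, hχ₀, hχ, hZ⟩ := exists_isRegular_mem_hereditary χ₀ Z
  have hpH : p ∈ hereditary χ := mem_hereditary_of_mem hZ (by simp [Z])
  have hcH : countableSubsets ∈ hereditary χ := mem_hereditary_of_mem hZ (by simp [Z])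
  have hWH : ∀ n, W n ∈ hereditary χ := fun n => mem_hereditary_of_mem hZ (by simp [Z])
  let X' : Set ZFSet.{0} := ({p, countableSubsets} ∪ Set.range W) ∪ subsetCode '' X
  have hX'H : X' ⊆ hereditary χ := by
    rintro x (((rfl | rfl) | ⟨n, rfl⟩) | ⟨c, -, rfl⟩)
    · exact hpH
    · exact hcH
    · exact hWH n
    · exact mem_hereditary_of_mem hpH (subsetCode_mem_powerset c)
  have hX' : #X' ≤ ℵ₁ := by
    refine (Cardinal.mk_union_le _ _).trans (Cardinal.add_le_of_le (Cardinal.aleph0_le_aleph 1) ?_ ?_)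
    · exact (Set.Countable.le_aleph0 (((Set.countable_singleton _).insert _).union
        (Set.countable_range W))).trans (Cardinal.aleph0_le_aleph 1)
    · have := Cardinal.mk_image_le_lift (f := subsetCode) (s := X)
      rw [Cardinal.lift_uzero] at this
      refine this.trans ?_
      simpa using Cardinal.lift_le.{1}.2 hX
  obtain ⟨M, ⟨hM, hMc⟩, hXM, S, hS, hsep⟩ := h χ hχ₀ hχ X' hX'H hX'
  have memM : ∀ {x}, x ∈ submodelCarrier M ↔ ∃ m : M, (m : ZFSet) = x := by
    intro x
    constructor
    · rintro ⟨m, hm, rfl⟩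
      exact ⟨⟨m, hm⟩, rfl⟩
    · rintro ⟨m, rfl⟩
      exact ⟨m, m.2, rfl⟩
  obtain ⟨pM, hpM⟩ := memM.1 (hXM (show p ∈ X' by simp [X']))
  obtain ⟨cM, hcM⟩ := memM.1 (hXM (show countableSubsets ∈ X' by simp [X']))
  have hWM : ∀ n, ∃ m : M, (m : ZFSet) = W n := fun n => memM.1 (hXM (show W n ∈ X' by simp [X']))
  choose wM hwM using hWM
  refine ⟨subsetCode ⁻¹' submodelCarrier M, fun c hc => hXM (Or.inr ⟨c, hc, rfl⟩), ?_, ?_, ?_⟩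
  · have := Cardinal.mk_preimage_of_injective_lift subsetCode (submodelCarrier M) subsetCode_injective
    rw [hM] at this
    simpa using this
  · intro C hC hCc
    -- `D` pads a possibly finite `C` to size exactly `ℵ₀`, as cofinality in `[M]^ℵ₀` requires.
    obtain ⟨D, hDM, hD⟩ : ∃ D ⊆ submodelCarrier M, #D = ℵ₀ := by
      refine Cardinal.le_mk_iff_exists_subset.1 ?_
      rw [hM]
      exact Cardinal.aleph0_le_aleph 1
    obtain ⟨y, hyM, hyM', hy, hxy⟩ := hMc (subsetCode '' C ∪ D)
      (Set.union_subset (by rintro _ ⟨c, hc, rfl⟩; exact hC hc) hDM) (by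
        refine le_antisymm ?_ (hD.symm.le.trans (Cardinal.mk_le_mk_of_subset Set.subset_union_right))
        exact ((hCc.image _).union (Cardinal.mk_le_aleph0_iff.1 hD.le)).le_aleph0)
    obtain ⟨yM, rfl⟩ := memM.1 hyM
    -- The cover `y` may contain sets that are not subsets of `ω`; in `H_χ` the set `y ∩ 𝒫(ω)` is a
    -- witness, so `M` has one too.
    obtain ⟨q, hqc, hq⟩ := ElementarySubstructure.exists_cover M pM yM cM (by
      have hu : ZFSet.sep (· ∈ p) (yM : ZFSet) ∈ countableSubsets := by
        rw [countableSubsets, ZFSet.mem_sep, ZFSet.mem_powerset]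
        refine ⟨fun w hw => (ZFSet.mem_sep.1 hw).2, ?_⟩
        exact Set.Countable.mono (fun w hw => (ZFSet.mem_sep.1 hw).1)
          (Set.countable_coe_iff.1 (Cardinal.mk_le_aleph0_iff.1 hy.le))
      refine ⟨⟨_, mem_hereditary_of_mem hcH hu⟩, ?_, ?_⟩
      · rw [hcM]
        exact hu
      · rw [hpM]
        exact fun w hw => ZFSet.mem_sep.2 ⟨hw.2, hw.1⟩)
    rw [hcM] at hqc
    refine ⟨enumeration q, fun c hc => mem_range_enumeration hqc ?_, fun n => ?_⟩
    · obtain ⟨m, hm⟩ := memM.1 (hC hc)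
      rw [← hm]
      refine hq m ⟨?_, hxy (Or.inl ⟨c, hc, hm.symm⟩)⟩
      rw [hpM, hm]
      exact subsetCode_mem_powerset c
    · obtain ⟨v, r, e, hv, hr, hqr, her, hpe, hve⟩ :=
        ElementarySubstructure.exists_value M q pM (wM n) (by
          let v := subsetCode (Φ (enumeration q) n)
          have hvp : v ∈ p := subsetCode_mem_powerset _
          let e : ZFSet.{0} := {p, v}
          let r : ZFSet.{0} := {(q : ZFSet), e}
          have hr : r ∈ W n := ZFSet.mem_range.2 ⟨⟨_, hqc⟩, rfl⟩
          have her : e ∈ r := by simp [r]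
          have hrH := mem_hereditary_of_mem (hWH n) hr
          refine ⟨⟨v, mem_hereditary_of_mem hpH hvp⟩, ⟨r, hrH⟩, ⟨e, mem_hereditary_of_mem hrH her⟩,
            ?_, ?_, ?_, her, ?_, ?_⟩
          · rw [hpM]; exact hvp
          · rw [hwM]; exact hr
          · simp [r]
          · rw [hpM]; simp [e]
          · simp [e])
      rw [hpM] at hv hpe
      rw [hwM] at hr
      have := eq_of_mem_graphCode hqc hv hr hqr her hpe hve
      exact memM.2 ⟨v, this⟩
  · intro b T hT hTb hTc
    have hmem : ∀ {c : Set ℕ}, (⟨subsetCode c, subsetCode_mem_powerset c⟩ :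
        ZFSet.powerset ZFSet.omega) ∈ S ↔ subsetCode c ∈ submodelCarrier M := by
      intro c
      rw [← SetLike.mem_coe, hS]
      rfl
    let code : Set ℕ → ZFSet.powerset ZFSet.omega :=
      fun c => ⟨subsetCode c, subsetCode_mem_powerset c⟩
    have hle : ∀ {c d}, code c ≤ code d ↔ c ⊆ d := subsetCode_subset_iff
    have hinj : Function.Injective code := fun c d hcd =>
      subsetCode_injective (Subtype.ext_iff.1 hcd)
    obtain ⟨⟨a, ha⟩, haS, hab, hcount⟩ := hsep (code b) (code '' T) (by
      rintro _ ⟨c, hc, rfl⟩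
      exact ⟨hmem.2 (hT hc), hle.2 (hTb c hc)⟩) (fun hc =>
        hTc (Set.countable_of_injective_of_countable_image hinj.injOn hc))
    obtain ⟨a, rfl⟩ := exists_subsetCode_eq ha
    refine ⟨a, hmem.1 haS, hle.1 hab, fun hc => hcount ?_⟩
    refine (hc.image code).mono ?_
    rintro _ ⟨⟨c, hc, rfl⟩, hca⟩
    exact ⟨c, ⟨hc, hle.1 hca⟩, rfl⟩

/-! ### The interpolating filtration of length `ω₁` -/

/-- The well-order of type `ω₁`. -/
abbrev OmegaOneType : Type := (Cardinal.ord ℵ₁).ToType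

theorem mk_omegaOneType : #OmegaOneType = ℵ₁ := Cardinal.mk_ord_toType _

theorem not_countable_omegaOneType : ¬ Countable OmegaOneType := by
  rw [← Cardinal.mk_le_aleph0_iff, mk_omegaOneType, not_le]
  exact Cardinal.aleph0_lt_aleph_one

theorem countable_Iio_omegaOneType (α : OmegaOneType) : (Set.Iio α).Countable := by
  have h : #(Set.Iio α) < #OmegaOneType :=
    Cardinal.mk_Iio_lt α (by rw [mk_omegaOneType, Ordinal.type_toType])
  have h' := h.trans_eq (mk_omegaOneType.trans Cardinal.succ_aleph0.symm)
  exact Set.countable_coe_iff.1 (Cardinal.mk_le_aleph0_iff.1 (Order.lt_succ_iff.1 h'))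

theorem countable_Iic_omegaOneType (α : OmegaOneType) : (Set.Iic α).Countable := by
  rw [← Set.Iio_insert]
  exact (countable_Iio_omegaOneType α).insert α

theorem exists_forall_lt_of_countable {B : Set OmegaOneType} (hB : B.Countable) :
    ∃ α, ∀ β ∈ B, β < α := by
  have h : (⋃ β ∈ B, Set.Iic β).Countable := hB.biUnion fun β _ => countable_Iic_omegaOneType β
  by_contra! hne
  refine not_countable_omegaOneType (Set.countable_univ_iff.1 (h.mono fun α _ => ?_))
  obtain ⟨β, hβ, hαβ⟩ := hne α
  exact Set.mem_biUnion hβ hαβ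

/-- From `SEP(𝒫(ω))`, a family `A` of at most `ℵ₁` sets of natural numbers and `ω₁` many sequences,
almost all of which contain, for a given `b`, a cofinal part of `A ↾ b`. -/
theorem SEP.exists_filtration (h : SEP (ZFSet.powerset ZFSet.omega))
    (Φ : (ℕ → Set ℕ) → ℕ → Set ℕ) (X : Set (Set ℕ)) (hX : #X ≤ ℵ₁) :
    ∃ A : Set (Set ℕ), X ⊆ A ∧ #A ≤ ℵ₁ ∧ ∃ s : OmegaOneType → ℕ → Set ℕ,
      (∀ α n, Φ (s α) n ∈ A) ∧ (∀ a ∈ A, {α | a ∉ Set.range (s α)}.Countable) ∧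
      ∀ b, {α | ¬ ∀ a ∈ A, a ⊆ b → ∃ i, a ⊆ s α i ∧ s α i ⊆ b}.Countable := by
  obtain ⟨A, hXA, hA, hcov, hsep⟩ := h.exists_family Φ X hX
  have : Nonempty A := by
    obtain ⟨s, -, hs⟩ := hcov ∅ (Set.empty_subset _) Set.countable_empty
    exact ⟨⟨_, hs 0⟩⟩
  obtain ⟨m, hm⟩ : ∃ m : OmegaOneType → A, Function.Surjective m := by
    rw [← mk_omegaOneType, Cardinal.le_def] at hA
    obtain ⟨f⟩ := hA
    exact ⟨Function.invFun f, Function.invFun_surjective f.injective⟩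
  have hs : ∀ α, ∃ s : ℕ → Set ℕ, (∀ β < α, (m β : Set ℕ) ∈ Set.range s) ∧ ∀ n, Φ s n ∈ A := by
    intro α
    obtain ⟨s, hs, hΦ⟩ := hcov ((fun β => (m β : Set ℕ)) '' Set.Iio α)
      (by rintro _ ⟨β, -, rfl⟩; exact (m β).2) ((countable_Iio_omegaOneType α).image _)
    exact ⟨s, fun β hβ => hs ⟨β, hβ, rfl⟩, hΦ⟩
  choose s hs hΦ using hs
  have hrange : ∀ a ∈ A, {α | a ∉ Set.range (s α)}.Countable := by
    intro a ha
    obtain ⟨β, hβ⟩ := hm ⟨a, ha⟩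
    refine (countable_Iic_omegaOneType β).mono fun α hα => ?_
    by_contra hlt
    refine hα ?_
    have := hs α β (not_le.1 hlt)
    rwa [hβ] at this
  refine ⟨A, hXA, hA, s, hΦ, hrange, fun b => ?_⟩
  by_contra hB
  set B := {α | ¬ ∀ a ∈ A, a ⊆ b → ∃ i, a ⊆ s α i ∧ s α i ⊆ b} with hBdef
  have hch : ∀ α : B, ∃ a ∈ A, a ⊆ b ∧ ∀ i, a ⊆ s α i → ¬ s α i ⊆ b := by
    rintro ⟨α, hα⟩
    simpa [hBdef] using hα
  choose t htA htb ht using hch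
  -- All but countably many `s α` list `a`; for such a bad `α`, `t α ⊆ a` would make `a` a forbidden
  -- interpolant.
  have hfib : ∀ a ∈ A, a ⊆ b → {α : B | t α ⊆ a}.Countable := by
    intro a ha hab
    refine ((hrange a ha).preimage Subtype.val_injective).mono ?_
    rintro α hα ⟨i, hi⟩
    exact ht α i (hi.symm ▸ hα) (hi.symm ▸ hab)
  have hT : ¬ (Set.range t).Countable := by
    intro hc
    refine hB (Set.countable_coe_iff.1 (Set.countable_univ_iff.1 ?_))
    have : (⋃ c ∈ Set.range t, {α : B | t α ⊆ c}).Countable :=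
      hc.biUnion fun c hc => by
        obtain ⟨α, rfl⟩ := hc
        exact hfib _ (htA α) (htb α)
    exact this.mono fun α _ => Set.mem_biUnion (Set.mem_range_self α) (Set.Subset.refl (t α))
  -- Separability yields an `a` above uncountably many of the `t α`, against `hfib`.
  obtain ⟨a, ha, hab, hunc⟩ := hsep b (Set.range t) (by rintro _ ⟨α, rfl⟩; exact htA α)
    (by rintro _ ⟨α, rfl⟩; exact htb α) hT
  refine hunc (((hfib a ha hab).image t).mono ?_)
  rintro _ ⟨⟨α, rfl⟩, hα⟩
  exact ⟨α, hα, rfl⟩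

/-! ### Luzin sequences and `non(𝓜)` -/

/-- From `SEP(𝒫(ω))`, a Luzin sequence of length `ω₁` in any second countable space of second
category. -/
theorem SEP.exists_luzin (h : SEP (ZFSet.powerset ZFSet.omega)) (E : Type) [TopologicalSpace E]
    [SecondCountableTopology E] (hE : ¬ IsMeagre (Set.univ : Set E)) :
    ∃ x : OmegaOneType → E, ∀ F, IsMeagre F → {α | x α ∈ F}.Countable := by
  have : Nonempty E := (nonempty_of_not_isMeagre hE).to_type
  obtain ⟨I, hI⟩ : ∃ I : ℕ → Set E, TopologicalSpace.IsTopologicalBasis (Set.range I) := by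
    have hb := TopologicalSpace.isBasis_countableBasis E
    have hne : (TopologicalSpace.countableBasis E).Nonempty := by
      obtain ⟨u, hu, -⟩ := hb.exists_subset_of_mem_open (Set.mem_univ (Classical.arbitrary E)) isOpen_univ
      exact ⟨u, hu⟩
    obtain ⟨I, hI⟩ := (TopologicalSpace.countable_countableBasis E).exists_eq_range hne
    exact ⟨I, hI ▸ hb⟩
  -- The `n`-th section of `a` is read as a list of allowed basic sets; `K a n` holds the points all
  -- of whose basic neighbourhoods are allowed.
  let K : Set ℕ → ℕ → Set E := fun a n => {x | ∀ k, x ∈ I k → Nat.pair n k ∈ a}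
  have hpt : ∀ s : ℕ → Set ℕ, ∃ x, ∀ i n, IsMeagre (K (s i) n) → x ∉ K (s i) n := by
    intro s
    by_contra! hcon
    refine hE ((isMeagre_biUnion (Set.to_countable {p : ℕ × ℕ | IsMeagre (K (s p.1) p.2)})
      (f := fun p => K (s p.1) p.2) fun p hp => hp).mono fun x _ => ?_)
    obtain ⟨i, n, hm, hx⟩ := hcon x
    exact Set.mem_biUnion (x := (i, n)) hm hx
  choose pt hpt using hpt
  obtain ⟨A, -, -, s, hΦ, -, hs⟩ := h.exists_filtration
    (fun s n => {j | ∃ k, pt s ∈ I k ∧ Nat.pair n k = j}) ∅ (by simp)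
  refine ⟨fun α => pt (s α), fun F hF => ?_⟩
  obtain ⟨S, hS, hSc, hFS⟩ := isMeagre_iff_countable_union_isNowhereDense.1 hF
  obtain ⟨f, hf⟩ := (hSc.insert ∅).exists_eq_range (Set.insert_nonempty _ _)
  have hfn : ∀ n, IsNowhereDense (f n) := by
    intro n
    rcases (hf ▸ Set.mem_range_self n : f n ∈ insert ∅ S) with hn | hn
    · rw [hn]; exact isNowhereDense_empty
    · exact hS _ hn
  -- Chosen so that `a ⊆ b` forces `K a n` into the closure of the nowhere dense `f n`.
  let b : Set ℕ := {j | (I j.unpair.2 ∩ f j.unpair.1).Nonempty}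
  refine (hs b).mono ?_
  intro α hα hgood
  obtain ⟨u, hu, hxu⟩ := hFS hα
  obtain ⟨n, rfl⟩ : u ∈ Set.range f := hf ▸ Set.mem_insert_of_mem _ hu
  obtain ⟨i, hi, hib⟩ := hgood _ (hΦ α n) (by
    rintro _ ⟨k, hk, rfl⟩
    simp only [b, Set.mem_ofPred_eq, Nat.unpair_pair]
    exact ⟨_, hk, hxu⟩)
  refine hpt (s α) i n ((hfn n).closure.isMeagre.mono fun x hx => ?_) fun k hk => hi ⟨k, hk, rfl⟩
  rw [hI.mem_closure_iff]
  rintro _ ⟨k, rfl⟩ hxk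
  have := hib (hx k hxk)
  simpa only [b, Set.mem_ofPred_eq, Nat.unpair_pair] using this

theorem isMeagre_of_countable {E : Type*} [TopologicalSpace E] [T1Space E]
    [∀ x : E, (nhdsWithin x {x}ᶜ).NeBot] {X : Set E} (hX : X.Countable) : IsMeagre X := by
  have := isMeagre_biUnion hX (f := fun x => ({x} : Set E)) fun x _ => by
    refine IsNowhereDense.isMeagre ?_
    rw [isClosed_singleton.isNowhereDense_iff, interior_singleton]
  simpa using this

theorem SEP.nonMeager_eq (h : SEP (ZFSet.powerset ZFSet.omega)) : nonMeager = ℵ₁ := by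
  obtain ⟨x, hx⟩ := h.exists_luzin ℝ (not_isMeagre_of_isOpen isOpen_univ Set.univ_nonempty)
  have hmem : #(Set.range x) ∈ {κ | ∃ X : Set ℝ, ¬ IsMeagre X ∧ #X = κ} := by
    refine ⟨_, fun hm => not_countable_omegaOneType (Set.countable_univ_iff.1 ?_), rfl⟩
    exact Set.Countable.mono (fun α _ => Set.mem_range_self (f := x) α) (hx _ hm)
  refine le_antisymm ((csInf_le' hmem).trans ?_) (le_csInf ⟨_, hmem⟩ ?_)
  · exact Cardinal.mk_range_le.trans mk_omegaOneType.le
  · rintro _ ⟨X, hX, rfl⟩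
    rw [← Cardinal.succ_aleph0, Order.succ_le_iff, ← not_le, Cardinal.mk_le_aleph0_iff]
    exact fun hc => hX (isMeagre_of_countable (Set.countable_coe_iff.1 hc))

/-! ### Category in `[ω]^ℵ₀` and groupwise density -/

open Filter Topology

/-- Having value `c` somewhere in `Y` beyond `m` is an open condition, and dense: resetting one
coordinate `k ∈ Y` of `z` gives points tending to `z` as `k` grows. -/
theorem residual_infinite_of_isInducing {E : Type*} [TopologicalSpace E] {f : E → ℕ → Bool}
    (hf : IsInducing f) {Y : Set ℕ} (hY : Y.Infinite) (c : Bool)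
    (h : ∀ z, ∀ k ∈ Y, ∃ w, f w k = c ∧ ∀ i ≠ k, f w i = f z i) :
    {z | {k | k ∈ Y ∧ f z k = c}.Infinite} ∈ residual E := by
  have hU : ∀ m : ℕ, {z | ∃ k > m, k ∈ Y ∧ f z k = c} ∈ residual E := by
    intro m
    refine residual_of_dense_open ?_ ?_
    · have : {z | ∃ k > m, k ∈ Y ∧ f z k = c} =
          ⋃ k ∈ {k | k > m ∧ k ∈ Y}, (fun z => f z k) ⁻¹' {c} := by
        ext z
        simp [and_assoc]
      rw [this]
      refine isOpen_biUnion fun k _ => (isOpen_discrete {c}).preimage ?_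
      exact (continuous_apply k).comp hf.continuous
    · intro z
      have : Nonempty E := ⟨z⟩
      choose! w hw hwz using h z
      have hfreq := Nat.frequently_atTop_iff_infinite.2 hY
      let w' : ℕ → E := fun k => open Classical in if k ∈ Y then w k else z
      have htend : Tendsto w' atTop (𝓝 z) := by
        rw [hf.tendsto_nhds_iff, tendsto_pi_nhds]
        intro i
        refine tendsto_const_nhds.congr' ?_
        filter_upwards [eventually_gt_atTop i] with k hk
        by_cases hkY : k ∈ Y
        · simp only [Function.comp, w', hkY, if_true]
          exact (hwz k hkY i hk.ne).symm
        · simp [w', hkY]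
      refine mem_closure_of_frequently_of_tendsto ?_ htend
      refine (hfreq.and_eventually (eventually_gt_atTop m)).mono fun k hk => ?_
      refine ⟨k, hk.2, hk.1, ?_⟩
      have hwk : w' k = w k := if_pos hk.1
      rw [hwk]
      exact hw k hk.1
  filter_upwards [countable_iInter_mem.2 hU] with z hz
  refine Set.infinite_of_not_bddAbove ?_
  rintro ⟨m, hm⟩
  obtain ⟨k, hk, hkY, hkc⟩ := Set.mem_iInter.1 hz m
  exact absurd (hm ⟨hkY, hkc⟩) (not_le.2 hk)

namespace InfiniteSubset

theorem isInducing_char : IsInducing char := ⟨rfl⟩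

/-- An infinite set of natural numbers, as a point of `[ω]^ℵ₀`. -/
def ofInfinite (s : Set ℕ) (h : s.Infinite) : InfiniteSubset := ⟨s, h⟩

theorem char_ofInfinite_eq_true {s : Set ℕ} {h : s.Infinite} {n : ℕ} :
    (ofInfinite s h).char n = true ↔ n ∈ s := by
  classical exact decide_eq_true_iff

theorem char_eq_true {x : InfiniteSubset} {n : ℕ} : x.char n = true ↔ n ∈ x.1 := by
  classical exact decide_eq_true_iff

theorem char_eq_false {x : InfiniteSubset} {n : ℕ} : x.char n = false ↔ n ∉ x.1 := by
  classical exact decide_eq_false_iff_not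

instance : SecondCountableTopology InfiniteSubset :=
  isInducing_char.secondCountableTopology

/-- The image of `[ω]^ℵ₀` in the Cantor space is comeagre, and meagreness would pass to that image.
-/
theorem not_isMeagre_univ : ¬ IsMeagre (Set.univ : Set InfiniteSubset) := by
  intro h
  have h' := isInducing_char.isMeagre_image h
  have hres := residual_infinite_of_isInducing (E := ℕ → Bool) IsInducing.id
    (Set.infinite_univ (α := ℕ)) true fun z k _ =>
      ⟨Function.update z k true, by simp, fun i hi => by simp [hi]⟩
  refine not_isMeagre_of_mem_residual hres (h'.mono fun z hz => ?_)
  refine ⟨ofInfinite {k | z k = true} (by simpa using hz), trivial, ?_⟩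
  funext n
  rw [Bool.eq_iff_iff, char_ofInfinite_eq_true]
  exact Iff.rfl

theorem residual_inter_infinite {Y : Set ℕ} (hY : Y.Infinite) :
    {z : InfiniteSubset | (z.1 ∩ Y).Infinite} ∈ residual InfiniteSubset := by
  filter_upwards [residual_infinite_of_isInducing isInducing_char hY true fun z k _ =>
    ⟨ofInfinite (insert k z.1) (z.2.mono (Set.subset_insert _ _)),
      char_ofInfinite_eq_true.2 (Set.mem_insert _ _), fun i hi => by
        rw [Bool.eq_iff_iff, char_ofInfinite_eq_true, char_eq_true, Set.mem_insert_iff]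
        exact or_iff_right hi⟩] with z hz
  exact hz.mono fun k hk => ⟨char_eq_true.1 hk.2, hk.1⟩

theorem residual_diff_infinite {Y : Set ℕ} (hY : Y.Infinite) :
    {z : InfiniteSubset | (Y \ z.1).Infinite} ∈ residual InfiniteSubset := by
  filter_upwards [residual_infinite_of_isInducing isInducing_char hY false fun z k _ =>
    ⟨ofInfinite (z.1 \ {k}) (z.2.sdiff (Set.finite_singleton k)), by
        rw [← Bool.not_eq_true, char_ofInfinite_eq_true]
        exact fun h => h.2 rfl, fun i hi => by
        rw [Bool.eq_iff_iff, char_ofInfinite_eq_true, char_eq_true]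
        exact and_iff_left hi⟩] with z hz
  exact hz.mono fun k hk => ⟨hk.1, char_eq_false.1 hk.2⟩

end InfiniteSubset

/-- A non-meagre set meets the comeagre set of all `z` having infinite intersection with `y`; shrink
such a `z` to `z ∩ y`. -/
theorem IsGroupwiseDense.exists_subset {G : Set InfiniteSubset} (hG : IsGroupwiseDense G)
    (y : InfiniteSubset) : ∃ z ∈ G, z.1 ⊆ y.1 := by
  have : ∃ z ∈ G, (z.1 ∩ y.1).Infinite := by
    by_contra! hcon
    refine hG.2 (IsMeagre.mono (s := {z : InfiniteSubset | (z.1 ∩ y.1).Infinite}ᶜ) ?_ ?_)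
    · exact fun z hz hinf => hinf (hcon z hz)
    · rw [IsMeagre, compl_compl]
      exact InfiniteSubset.residual_inter_infinite y.2
  obtain ⟨z, hz, hzy⟩ := this
  refine ⟨⟨z.1 ∩ y.1, hzy⟩, hG.1 z hz _ ?_, Set.inter_subset_right⟩
  simp [Set.sdiff_eq_empty.2 (Set.inter_subset_left (s := z.1) (t := y.1))]

/-- Choose a decreasing sequence through the members of `F`; a pseudo-intersection of it belongs to
all of them. -/
theorem sInter_nonempty_of_isGroupwiseDense {F : Set (Set InfiniteSubset)} (hF : F.Countable)
    (h : ∀ G ∈ F, IsGroupwiseDense G) : (⋂₀ F).Nonempty := by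
  rcases F.eq_empty_or_nonempty with rfl | hne
  · simpa using nonempty_of_not_isMeagre InfiniteSubset.not_isMeagre_univ
  obtain ⟨G, rfl⟩ := hF.exists_eq_range hne
  have hG : ∀ n, IsGroupwiseDense (G n) := fun n => h _ ⟨n, rfl⟩
  choose sub hsub hsub' using fun n => (hG n).exists_subset
  let y : ℕ → InfiniteSubset := fun n =>
    Nat.rec (sub 0 ⟨Set.univ, Set.infinite_univ⟩) (fun n z => sub (n + 1) z) n
  have hyG : ∀ n, y n ∈ G n := by
    rintro (_ | n)
    · exact hsub _ _
    · exact hsub _ _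
  have hanti : Antitone fun n => (y n).1 := antitone_nat_of_succ_le fun n => hsub' (n + 1) (y n)
  obtain ⟨φ, hφ, hφy⟩ := extraction_forall_of_frequently (P := fun n k => k ∈ (y n).1)
    fun n => Nat.frequently_atTop_iff_infinite.2 (y n).2
  refine ⟨⟨Set.range φ, Set.infinite_range_of_injective hφ.injective⟩, ?_⟩
  rintro _ ⟨n, rfl⟩
  refine (hG n).1 _ (hyG n) _ (((Set.finite_Iio n).image φ).subset ?_)
  rintro _ ⟨⟨k, rfl⟩, hk⟩
  refine ⟨k, ?_, rfl⟩
  by_contra hle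
  exact hk (hanti (not_lt.1 hle) (hφy k))

theorem SEP.groupwiseDensityNumber_eq (h : SEP (ZFSet.powerset ZFSet.omega)) :
    groupwiseDensityNumber = ℵ₁ := by
  obtain ⟨x, hx⟩ := h.exists_luzin InfiniteSubset InfiniteSubset.not_isMeagre_univ
  let G : OmegaOneType → Set InfiniteSubset := fun α => {y | ∃ β, α ≤ β ∧ (y.1 \ (x β).1).Finite}
  have hG : ∀ α, IsGroupwiseDense (G α) := by
    refine fun α => ⟨?_, fun hm => ?_⟩
    · rintro y ⟨β, hαβ, hfin⟩ z hz
      refine ⟨β, hαβ, (hz.union hfin).subset fun k hk => ?_⟩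
      by_cases hky : k ∈ y.1
      · exact Or.inr ⟨hky, hk.2⟩
      · exact Or.inl ⟨hk.1, hky⟩
    -- `G α` contains the tail of the Luzin sequence from `α` on, so it cannot be meagre.
    · refine not_countable_omegaOneType (Set.countable_univ_iff.1
        (((hx _ hm).union (countable_Iio_omegaOneType α)).mono fun β _ => ?_))
      rcases le_or_gt α β with hαβ | hαβ
      · exact Or.inl ⟨β, hαβ, by simp⟩
      · exact Or.inr hαβ
  have hempty : ⋂₀ Set.range G = ∅ := by
    rw [Set.eq_empty_iff_forall_notMem]
    intro y hy
    -- The sets almost including `y` form a meagre set, so the indices `β` with `y` almost included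
    -- in `x β` are bounded.
    obtain ⟨α, hα⟩ := exists_forall_lt_of_countable (hx {z | (y.1 \ z.1).Finite} (by
      rw [IsMeagre]
      exact InfiniteSubset.residual_diff_infinite y.2))
    obtain ⟨β, hαβ, hfin⟩ := hy (G α) ⟨α, rfl⟩
    exact absurd (hα β hfin) (not_lt.2 hαβ)
  have hmem : #(Set.range G) ∈ {κ | ∃ F : Set (Set InfiniteSubset),
      (∀ G ∈ F, IsGroupwiseDense G) ∧ ⋂₀ F = ∅ ∧ #F = κ} :=
    ⟨_, by rintro _ ⟨α, rfl⟩; exact hG α, hempty, rfl⟩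
  refine le_antisymm ((csInf_le' hmem).trans ?_) (le_csInf ⟨_, hmem⟩ ?_)
  · exact Cardinal.mk_range_le.trans mk_omegaOneType.le
  · rintro _ ⟨F, hF, hF', rfl⟩
    rw [← Cardinal.succ_aleph0, Order.succ_le_iff, ← not_le, Cardinal.mk_le_aleph0_iff]
    intro hc
    have := sInter_nonempty_of_isGroupwiseDense (Set.countable_coe_iff.1 hc) hF
    simp [hF'] at this

/-! ### Generic interval sequences and `cov(𝓜)` -/

/-- By compactness `E` has an accumulation point, and each of its neighbourhoods contains infinitely
many points of `E`. -/
theorem Set.Infinite.exists_forall_agree_infinite {E : Set (ℕ → Bool)} (hE : E.Infinite) :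
    ∃ y : ℕ → Bool, ∀ L, {z | z ∈ E ∧ ∀ k < L, z k = y k}.Infinite := by
  obtain ⟨y, hy⟩ := hE.exists_accPt_principal
  refine ⟨y, fun L hfin => ?_⟩
  have hU : {z : ℕ → Bool | ∀ k < L, z k = y k} ∈ 𝓝 y := by
    have : {z : ℕ → Bool | ∀ k < L, z k = y k} = ⋂ k ∈ Set.Iio L, (fun z => z k) ⁻¹' {y k} := by
      ext z
      simp
    rw [this, biInter_mem (Set.finite_Iio L)]
    exact fun k _ => (continuous_apply k).continuousAt.preimage_mem_nhds (by simp)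
  have hV : ({z | z ∈ E ∧ ∀ k < L, z k = y k} \ {y})ᶜ ∈ 𝓝 y :=
    (hfin.subset Set.sdiff_subset).isClosed.isOpen_compl.mem_nhds (by simp)
  obtain ⟨z, ⟨⟨hzU, hzV⟩, hzE⟩, hzy⟩ := accPt_iff_nhds.1 hy _ (inter_mem hU hV)
  exact hzV ⟨⟨hzE, hzU⟩, hzy⟩

/-- Given countably many subsets of the Cantor space, there is a descending sequence of locally
constant functions with values in `ℕ` which, on each of the infinite sets, takes every value below
some `σ`. -/
theorem exists_locallyConstant_dense (le : ℕ → ℕ → Prop) (E : ℕ → Set (ℕ → Bool)) :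
    ∃ f : ℕ → (ℕ → Bool) → ℕ,
      (∀ n, ∃ L, ∀ z w : ℕ → Bool, (∀ k < L, w k = z k) → f n w = f n z) ∧
      (∀ n z, f (n + 1) z = f n z ∨ le (f (n + 1) z) (f n z)) ∧
      ∀ i, (E i).Infinite → ∃ σ, ∀ τ, le τ σ → ∃ z ∈ E i, ∃ n, f n z = τ := by
  classical
  have hy : ∀ i, ∃ y : ℕ → Bool,
      (E i).Infinite → ∀ L, {z | z ∈ E i ∧ ∀ k < L, z k = y k}.Infinite := by
    intro i
    by_cases hi : (E i).Infinite
    · obtain ⟨y, hy⟩ := hi.exists_forall_agree_infinite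
      exact ⟨y, fun _ => hy⟩
    · exact ⟨fun _ => false, fun h => absurd h hi⟩
  choose y hy using hy
  -- Stage `m = Nat.pair i τ` picks a clopen `V` around a point of `E i` that agrees with `y i` up
  -- to `L`, while keeping `y 0, …, y m` outside `V`.
  have hstep : ∀ m L : ℕ, ∃ (V : Set (ℕ → Bool)) (L' : ℕ), L ≤ L' ∧
      (∀ z w : ℕ → Bool, (∀ k < L', w k = z k) → (w ∈ V ↔ z ∈ V)) ∧ (∀ j ≤ m, y j ∉ V) ∧
      ((E m.unpair.1).Infinite →
        ∃ z ∈ E m.unpair.1, z ∈ V ∧ ∀ k < L, z k = y m.unpair.1 k) := by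
    intro m L
    by_cases hi : (E m.unpair.1).Infinite
    · obtain ⟨z, ⟨hzE, hz⟩, hzy⟩ :=
        ((hy _ hi L).sdiff ((Set.finite_Iic m).image y)).nonempty
      have hne : ∀ j, ∃ k, j ≤ m → z k ≠ y j k := by
        intro j
        by_contra! hcon
        exact hzy ⟨j, (hcon 0).1, funext fun k => (hcon k).2.symm⟩
      choose d hd using hne
      refine ⟨{w | ∀ k < max L ((Finset.range (m + 1)).sup d + 1), w k = z k},
        max L ((Finset.range (m + 1)).sup d + 1), le_max_left _ _,
        fun z' w h => ?_, fun j hj hmem => ?_, fun _ => ⟨z, hzE, fun _ _ => rfl, hz⟩⟩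
      · exact forall₂_congr fun k hk => by rw [h k hk]
      · refine hd j hj (hmem (d j) (lt_max_of_lt_right (Nat.lt_succ_of_le ?_))).symm
        exact Finset.le_sup (Finset.mem_range.2 (Nat.lt_succ_of_le hj))
    · exact ⟨∅, L, le_rfl, fun _ _ _ => Iff.rfl, fun _ _ h => h, fun h => absurd h hi⟩
  choose V' L' hL' hdep hyV hz using hstep
  let L : ℕ → ℕ := fun m => Nat.rec 0 (fun m l => L' m l) m
  let V : ℕ → Set (ℕ → Bool) := fun m => V' m (L m)
  have hL : Monotone L := monotone_nat_of_le_succ fun m => hL' m (L m)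
  have hV : ∀ m z w, (∀ k < L (m + 1), w k = z k) → (w ∈ V m ↔ z ∈ V m) := fun m => hdep m (L m)
  let f : ℕ → (ℕ → Bool) → ℕ := fun n z =>
    Nat.rec 0 (fun m p => if z ∈ V m ∧ le m.unpair.2 p then m.unpair.2 else p) n
  have hf : ∀ n z, f (n + 1) z =
      if z ∈ V n ∧ le n.unpair.2 (f n z) then n.unpair.2 else f n z := fun _ _ => rfl
  have hagree : ∀ n (z w : ℕ → Bool), (∀ k < L n, w k = z k) → f n w = f n z := by
    intro n
    induction n with
    | zero => exact fun _ _ _ => rfl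
    | succ n ih =>
      intro z w h
      rw [hf, hf, ih z w fun k hk => h k (hk.trans_le (hL n.le_succ)), hV n z w h]
  refine ⟨f, fun n => ⟨L n, hagree n⟩, fun n z => ?_, fun i hi => ⟨f i (y i), fun τ hτ => ?_⟩⟩
  · rw [hf]
    split_ifs with h
    · exact Or.inr h.2
    · exact Or.inl rfl
  -- From stage `i` on, the value at `y i` is frozen; this is `σ`. Points of `E i` near `y i` share
  -- it until their stage changes it to `τ`.
  · have hstay : ∀ n, i ≤ n → f n (y i) = f i (y i) := by
      intro n hn
      induction n, hn using Nat.le_induction with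
      | base => rfl
      | succ n hn ih => rw [hf, if_neg fun h => hyV n (L n) i hn h.1, ih]
    obtain ⟨z, hzE, hzV, hzy⟩ := hz (Nat.pair i τ) (L (Nat.pair i τ)) (by simpa using hi)
    rw [Nat.unpair_pair] at hzE hzy
    refine ⟨z, hzE, Nat.pair i τ + 1, ?_⟩
    rw [hf, hagree _ (y i) z hzy, hstay _ (Nat.left_le_pair i τ), Nat.unpair_pair]
    exact if_pos ⟨hzV, hτ⟩

/-- The nondegenerate closed rational intervals: Cohen conditions with compactness, so that nested
sequences have a common point. -/
theorem exists_compact_refining_sequence :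
    ∃ K : ℕ → Set ℝ, (∀ p, IsCompact (K p)) ∧ (∀ p, (K p).Nonempty) ∧
      ∀ U, IsOpen U → Dense U → ∀ p, ∃ q, K q ⊆ K p ∧ K q ⊆ U := by
  let ι := {p : ℚ × ℚ // p.1 < p.2}
  have : Nonempty ι := ⟨⟨(0, 1), by norm_num⟩⟩
  obtain ⟨e, he⟩ := exists_surjective_nat ι
  refine ⟨fun n => Set.Icc ((e n).1.1 : ℝ) ((e n).1.2 : ℝ), fun _ => isCompact_Icc, fun n => ?_, ?_⟩
  · exact Set.nonempty_Icc.2 (Rat.cast_le.2 (e n).2.le)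
  · intro U hU hd p
    have hlt : ((e p).1.1 : ℝ) < ((e p).1.2 : ℝ) := Rat.cast_lt.2 (e p).2
    obtain ⟨t, ht⟩ := hd.inter_open_nonempty _ isOpen_Ioo (Set.nonempty_Ioo.2 hlt)
    obtain ⟨ε, hε, hball⟩ := Metric.isOpen_iff.1 (isOpen_Ioo.inter hU) t ht
    rw [Real.ball_eq_Ioo] at hball
    obtain ⟨a, ha, hat⟩ := exists_rat_btwn (sub_lt_self t hε)
    obtain ⟨b, hbt, hb⟩ := exists_rat_btwn (lt_add_of_pos_right t hε)
    obtain ⟨q, hq⟩ := he ⟨(a, b), Rat.cast_lt.1 (hat.trans hbt)⟩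
    have hsub : Set.Icc (a : ℝ) b ⊆ Set.Ioo ((e p).1.1 : ℝ) ((e p).1.2 : ℝ) ∩ U :=
      (Set.Icc_subset_Ioo ha hb).trans hball
    refine ⟨q, ?_, ?_⟩
    · simp only [hq]
      exact fun r hr => Set.Ioo_subset_Icc_self (hsub hr).1
    · simp only [hq]
      exact fun r hr => (hsub hr).2

theorem exists_cylinder_enumeration :
    ∃ B : ℕ → Set (ℕ → Bool), ∀ (z : ℕ → Bool) (L : ℕ),
      ∃ k, B k = {w | ∀ i < L, w i = z i} := by
  obtain ⟨e, he⟩ := exists_surjective_nat (Σ n, Fin n → Bool)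
  refine ⟨fun k => {w | ∀ i : Fin (e k).1, w i = (e k).2 i}, fun z L => ?_⟩
  obtain ⟨k, hk⟩ := he ⟨L, fun i => z i⟩
  refine ⟨k, ?_⟩
  ext w
  rw [Set.mem_ofPred_eq, hk]
  exact ⟨fun h i hi => h ⟨i, hi⟩, fun h i => h i i.2⟩

/-- If `SEP(𝒫(ω))` holds and the continuum hypothesis fails, then any `ℵ₁` many dense open sets of
reals have a common point. -/
theorem SEP.sInter_nonempty_of_dense_open (h : SEP (ZFSet.powerset ZFSet.omega))
    (hc : Cardinal.continuum.{0} ≠ ℵ₁) (𝒰 : Set (Set ℝ)) (h𝒰 : #𝒰 ≤ ℵ₁)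
    (hod : ∀ U ∈ 𝒰, IsOpen U ∧ Dense U) : (⋂₀ 𝒰).Nonempty := by
  obtain ⟨K, hKc, hKn, hK⟩ := exists_compact_refining_sequence
  obtain ⟨B, hB⟩ := exists_cylinder_enumeration
  let E : Set ℕ → Set (ℕ → Bool) := fun a => {z | ∀ k ∈ a, z ∉ B k}
  let code : (ℕ → Bool) → Set ℕ := fun x => {n | x n = true}
  have hcode : Function.Injective code := fun x y hxy => funext fun n =>
    Bool.eq_iff_iff.2 (Set.ext_iff.1 hxy n)
  have henum : ∀ a, ∃ g : ℕ → ℕ → Bool, (E a).Finite → E a ⊆ Set.range g := by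
    intro a
    by_cases ha : (E a).Finite
    · obtain ⟨g, hg⟩ := (ha.countable.insert fun _ => false).exists_eq_range (Set.insert_nonempty _ _)
      exact ⟨g, fun _ => hg ▸ Set.subset_insert _ _⟩
    · exact ⟨fun _ _ => false, fun h => absurd h ha⟩
  choose enum henum using henum
  choose f hfloc hfanti hfdense using fun s : ℕ → Set ℕ =>
    exists_locallyConstant_dense (fun p q => K p ⊆ K q) fun i => E (s i)
  -- Codes the triples `(k, n, p)` such that `f s n` is constantly `p` on the cylinder `B k`.
  let graph : (ℕ → Set ℕ) → Set ℕ := fun s =>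
    {j | ∀ z ∈ B j.unpair.1, f s j.unpair.2.unpair.1 z = j.unpair.2.unpair.2}
  let pre : Set ℕ → Set ℕ → Set ℕ := fun g D =>
    {k | ∃ n p, Nat.pair k (Nat.pair n p) ∈ g ∧ p ∈ D}
  -- Packs three closure operations into one `Φ`: the graph, the points of finite coded sets, and
  -- `pre`.
  obtain ⟨e, he⟩ := exists_surjective_nat (Unit ⊕ (ℕ × ℕ) ⊕ (ℕ × ℕ))
  let D : Set ℝ → Set ℕ := fun U => {p | K p ⊆ U}
  obtain ⟨A, hXA, hA, s, hΦ, hrange, hs⟩ := h.exists_filtration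
    (fun s n => Sum.elim (fun _ => graph s) (Sum.elim (fun ij => code (enum (s ij.1) ij.2))
      (fun ij => pre (s ij.1) (s ij.2))) (e n)) (D '' 𝒰) (Cardinal.mk_image_le.trans h𝒰)
  have hgraph : ∀ α, graph (s α) ∈ A := by
    intro α
    obtain ⟨n, hn⟩ := he (Sum.inl ())
    have := hΦ α n
    rwa [hn] at this
  have henumA : ∀ α i j, code (enum (s α i) j) ∈ A := by
    intro α i j
    obtain ⟨n, hn⟩ := he (Sum.inr (Sum.inl (i, j)))
    have := hΦ α n
    rwa [hn] at this
  have hpre : ∀ g ∈ A, ∀ d ∈ A, pre g d ∈ A := by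
    intro g hg d hd
    obtain ⟨α, hα⟩ := exists_forall_lt_of_countable ((hrange g hg).union (hrange d hd))
    have hgα : g ∈ Set.range (s α) := by
      by_contra hcon
      exact lt_irrefl _ (hα α (Or.inl hcon))
    have hdα : d ∈ Set.range (s α) := by
      by_contra hcon
      exact lt_irrefl _ (hα α (Or.inr hcon))
    obtain ⟨i, rfl⟩ := hgα
    obtain ⟨j, rfl⟩ := hdα
    obtain ⟨n, hn⟩ := he (Sum.inr (Sum.inr (i, j)))
    have := hΦ α n
    rwa [hn] at this
  obtain ⟨x, hx⟩ : ∃ x, code x ∉ A := by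
    by_contra! hcon
    have hle : #(ℕ → Bool) ≤ #A :=
      Cardinal.mk_le_of_injective (f := fun x => (⟨code x, hcon x⟩ : A)) fun x y hxy =>
        hcode (Subtype.ext_iff.1 hxy)
    refine hc (le_antisymm ?_ Cardinal.aleph_one_le_continuum)
    simpa using hle.trans hA
  let b : Set ℕ := {k | x ∉ B k}
  obtain ⟨α, hα⟩ := exists_forall_lt_of_countable (hs b)
  have hgood : ∀ a ∈ A, a ⊆ b → ∃ i, a ⊆ s α i ∧ s α i ⊆ b := by
    by_contra hcon
    exact lt_irrefl _ (hα α hcon)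
  obtain ⟨r, hr⟩ : (⋂ n, K (f (s α) n x)).Nonempty := by
    refine IsCompact.nonempty_iInter_of_sequence_nonempty_isCompact_isClosed _ (fun n => ?_)
      (fun n => hKn _) (hKc _) fun n => (hKc _).isClosed
    rcases hfanti (s α) n x with h | h
    · rw [h]
    · exact h
  refine ⟨r, fun U hU => ?_⟩
  obtain ⟨hUo, hUd⟩ := hod U hU
  have hpA := hpre _ (hgraph α) _ (hXA ⟨U, hU, rfl⟩)
  -- If the inclusion fails, a cylinder containing `x` already decides an interval inside `U`. If it
  -- holds, an interpolant codes an infinite closed set containing `x`, on which no decision enters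
  -- `U`; density of the values refutes this.
  by_cases hab : pre (graph (s α)) (D U) ⊆ b
  · exfalso
    obtain ⟨i, hi, hib⟩ := hgood _ hpA hab
    have hxE : x ∈ E (s α i) := fun k hk => hib hk
    have hinf : (E (s α i)).Infinite := by
      intro hfin
      obtain ⟨j, hj⟩ := henum _ hfin hxE
      exact hx (hj ▸ henumA α i j)
    obtain ⟨σ, hσ⟩ := hfdense (s α) i hinf
    obtain ⟨τ, hτσ, hτU⟩ := hK U hUo hUd σ
    obtain ⟨z, hzE, n, hn⟩ := hσ τ hτσ
    obtain ⟨L, hL⟩ := hfloc (s α) n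
    obtain ⟨k, hk⟩ := hB z L
    refine hzE k (hi ⟨n, τ, ?_, hτU⟩) (hk ▸ fun _ _ => rfl)
    simp only [graph, Set.mem_ofPred_eq, Nat.unpair_pair]
    intro w hw
    rw [hk] at hw
    rw [hL z w hw, hn]
  · obtain ⟨k, ⟨n, p, hnp, hpU⟩, hkb⟩ := Set.not_subset.1 hab
    have hxk : x ∈ B k := not_not.1 hkb
    simp only [graph, Set.mem_ofPred_eq, Nat.unpair_pair] at hnp
    have := Set.mem_iInter.1 hr n
    rw [hnp x hxk] at this
    exact hpU this

theorem SEP.aleph_two_le_covMeager (h : SEP (ZFSet.powerset ZFSet.omega))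
    (hc : Cardinal.continuum.{0} ≠ ℵ₁) : Cardinal.aleph 2 ≤ covMeager := by
  refine le_csInf ⟨_, Set.range fun x : ℝ => ({x} : Set ℝ), ?_, ?_, rfl⟩ ?_
  · rintro _ ⟨x, rfl⟩
    exact isMeagre_of_countable (Set.countable_singleton x)
  · exact Set.eq_univ_of_forall fun x => ⟨{x}, ⟨x, rfl⟩, rfl⟩
  · rintro _ ⟨F, hF, hcov, rfl⟩
    by_contra! hlt
    have hF1 : #F ≤ ℵ₁ := by
      rw [← Order.lt_succ_iff, Cardinal.succ_aleph]
      simpa [← one_add_one_eq_two] using hlt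
    have hex : ∀ X : F, ∃ S : Set (Set ℝ), (∀ t ∈ S, IsOpen t ∧ Dense t) ∧ S.Countable ∧
        ⋂₀ S ⊆ (X : Set ℝ)ᶜ := by
      intro X
      obtain ⟨S, h1, h2, h3, h4⟩ := mem_residual_iff.1 (hF X X.2)
      exact ⟨S, fun t ht => ⟨h1 t ht, h2 t ht⟩, h3, h4⟩
    choose S hS hSc hSX using hex
    obtain ⟨r, hr⟩ := h.sInter_nonempty_of_dense_open hc (⋃ X, S X) (by
      refine (Cardinal.mk_iUnion_le S).trans ?_
      refine (mul_le_mul' hF1 (ciSup_le' fun X => (hSc X).le_aleph0)).trans ?_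
      exact (Cardinal.mul_eq_left (Cardinal.aleph0_le_aleph 1) (Cardinal.aleph0_le_aleph 1)
        Cardinal.aleph0_ne_zero).le) (by
      intro U hU
      obtain ⟨X, hX⟩ := Set.mem_iUnion.1 hU
      exact hS X U hX)
    obtain ⟨X, hX, hrX⟩ := (hcov ▸ Set.mem_univ r : r ∈ ⋃₀ F)
    exact hSX ⟨X, hX⟩ (fun U hU => hr U (Set.mem_iUnion.2 ⟨⟨X, hX⟩, hU⟩)) hrX

theorem theorem2p3 (h : SEP (ZFSet.powerset ZFSet.omega)) :
    nonMeager = ℵ₁ ∧ groupwiseDensityNumber = ℵ₁ ∧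
      (Cardinal.continuum ≠ ℵ₁ → Cardinal.aleph 2 ≤ covMeager) :=
  ⟨h.nonMeager_eq, h.groupwiseDensityNumber_eq, fun hc => h.aleph_two_le_covMeager fun hc₀ =>
    hc (by simpa using congrArg Cardinal.lift hc₀)⟩
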